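/- Let $n,r\in\mathbb{N}$, let $J:\mathbb{R}^n\to\mathbb{R}$ be a radially unbounded $\mathcal{C}^2$ function ($J(x)\to\infty$ as $|x|\to\infty$), let $x^\star\in\mathbb{R}^n$, $b_0:\mathbb{R}^n\to\mathbb{R}^n$, $b_{i,j}\in\mathbb{R}^n$ ($1\le i\le r$, $j\in\{1,2\}$), and let $\omega_1,\dots,\omega_r$ be pairwise distinct positive rational numbers. A class-$\mathcal{K}$ function is a continuous strictly increasing $\alpha:\mathbb{R}_{\ge0}\to\mathbb{R}_{\ge0}$ with $\alpha(0)=0$; it is of class $\mathcal{K}_\infty$ if also $\alpha(s)\to\infty$ as $s\to\infty$. A class-$\mathcal{KL}$ function is a continuous $\beta:\mathbb{R}_{\ge0}^2\to\mathbb{R}_{\ge0}$ such that $\beta(\cdot,s)\in\mathcal{K}_\infty$ for every $s\ge0$, $\beta(r,\cdot)$ is strictly decreasing for every $r>0$, and $\lim_{s\to\infty}\beta(r,s)=0$ for every $r\ge0$. Assume that there are constants $\gamma,\kappa_3>0$ with $\gamma>\kappa_3$ such that: 1. $\sum_{i=1}^r\sum_{j=1}^2(b_{i,j}^\top v)^2\ge\gamma|v|^2$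 for all $v\in\mathbb{R}^n$; 2. $J(x)>J(x^\star)$ for all $x\ne x^\star$; $\nabla J(x)=0$ if and only if $x=x^\star$; and there is $L_J>0$ with $|\nabla^2J(x)|\le L_J$ for all $x$; 3. $|b_0(x)|\le\kappa_3|\nabla J(x)|$ for all $x$, and there is $L_0>0$ with $|b_0(x_1)-b_0(x_2)|\le L_0|x_1-x_2|$ for all $x_1,x_2$; 4. there are a class-$\mathcal{K}$ function $\alpha_J$ and $M_J>0$ with $\alpha_J(|x-x^\star|)^2\le|\nabla J(x)|^2\le M_J^2$ for all $x$. For $\varepsilon>0$ consider, in the shifted coordinate $\tilde x=x-x^\star$, the system $$\dot{\tilde x}=b_0(\tilde x+x^\star)+\varepsilon^{-1}\sum_{i=1}^r\sum_{j=1}^2 b_{i,j}\,u_{i,j}(J(\tilde x+x^\star),\tau),\qquad \dot\tau=\varepsilon^{-2},$$ $$u_{i,1}(y,\tau)=\sqrt{2\omega_i}\cos(y+\omega_i\tau),\qquad u_{i,2}(y,\tau)=\sqrt{2\omega_i}\sin(y+\omega_i\tau).$$ Then the origin $\tilde x=0$ is uniformly globally practically asymptotically stable (UGpAS): there is a class-$\mathcal{KL}$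 function $\beta$ such that for every $\nu>0$ there is $\varepsilon^*>0$ such that, for all $\varepsilon\in(0,\varepsilon^*)$ and all $(\tilde x_0,\tau_0)\in\mathbb{R}^n\times\mathbb{R}_{\ge0}$, every $\mathcal{C}^1$ solution $(\tilde x,\tau)$ on an interval $[0,t_s)$, $0<t_s\le\infty$, with $(\tilde x(0),\tau(0))=(\tilde x_0,\tau_0)$ satisfies $|\tilde x(t)|\le\beta(|\tilde x_0|,t)+\nu$ for all $t\in[0,t_s)$, and every such solution that cannot be extended to a longer interval is complete ($t_s=\infty$). -/

import Mathlib

open Set Filter Topology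

noncomputable section

/-- Class `K`: continuous and strictly increasing on `[0, ∞)`, zero at zero
(so nonnegative on `[0, ∞)`; values at negative arguments are irrelevant). -/
structure IsClassK (α : ℝ → ℝ) : Prop where
  continuousOn : ContinuousOn α (Ici 0)
  strictMonoOn : StrictMonoOn α (Ici 0)
  map_zero : α 0 = 0

/-- Class `K∞`: class `K` and unbounded. -/
structure IsClassKInfty (α : ℝ → ℝ) : Prop extends IsClassK α where
  tendsto_atTop : Tendsto α atTop atTop

/-- Class `KL`: continuous on `[0, ∞) × [0, ∞)`, of class `K∞` in the first argument, tending to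
zero in the second argument and strictly decreasing in it. Strict decrease is only possible
for `r > 0`, since `β 0 s = 0` for every `s ≥ 0`. -/
structure IsClassKL (β : ℝ → ℝ → ℝ) : Prop where
  continuousOn : ContinuousOn (fun p : ℝ × ℝ => β p.1 p.2) (Ici 0 ×ˢ Ici 0)
  classKInfty : ∀ s, 0 ≤ s → IsClassKInfty (fun r => β r s)
  strictAntiOn : ∀ r, 0 < r → StrictAntiOn (β r) (Ici 0)
  tendsto_zero : ∀ r, 0 ≤ r → Tendsto (β r) atTop (𝓝 0)

/-- The half-open time interval `[0, T)`, where `T` may be `⊤`. -/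
def timeDomain (T : EReal) : Set ℝ := {t | 0 ≤ t ∧ (t : EReal) < T}

section Systems

variable {E : Type*} [NormedAddCommGroup E] [NormedSpace ℝ E]

/-- `(x, τ)` is a solution on `[0, T)`, `0 < T ≤ ∞`, of
`x' = f (x, τ)`, `τ' = ε⁻²` with `(x, τ) (0) = (x₀, τ₀)`.
Continuity of `t ↦ f (x t, τ t)` says that the solution is continuously differentiable. -/
structure IsSolution (f : E → ℝ → E) (ε : ℝ) (x₀ : E) (τ₀ : ℝ) (T : EReal)
    (x : ℝ → E) (τ : ℝ → ℝ) : Prop where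
  pos : 0 < T
  init_x : x 0 = x₀
  init_τ : τ 0 = τ₀
  deriv_x : ∀ t ∈ timeDomain T, HasDerivWithinAt x (f (x t) (τ t)) (timeDomain T) t
  deriv_τ : ∀ t ∈ timeDomain T, HasDerivWithinAt τ ((ε ^ 2)⁻¹) (timeDomain T) t
  cont : ContinuousOn (fun t => f (x t) (τ t)) (timeDomain T)

/-- A solution on `[0, T)` that is not the restriction of a solution on a longer interval. -/
def IsMaximalSolution (f : E → ℝ → E) (ε : ℝ) (x₀ : E) (τ₀ : ℝ) (T : EReal)
    (x : ℝ → E) (τ : ℝ → ℝ) : Prop :=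
  IsSolution f ε x₀ τ₀ T x τ ∧
    ¬ ∃ (T' : EReal) (y : ℝ → E) (σ : ℝ → ℝ), T < T' ∧ IsSolution f ε x₀ τ₀ T' y σ ∧
      EqOn y x (timeDomain T) ∧ EqOn σ τ (timeDomain T)

/-- Uniform global practical asymptotic stability of the origin for the family of systems
`x' = f ε (x, τ)`, `τ' = ε⁻²`. Every solution satisfies the bound as long as it is defined,
and every solution that cannot be continued is complete, so that it satisfies the bound for
all `t ≥ 0`. -/
def UGpAS (f : ℝ → E → ℝ → E) : Prop :=
  ∃ β : ℝ → ℝ → ℝ, IsClassKL β ∧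
    ∀ ν : ℝ, 0 < ν → ∃ εstar : ℝ, 0 < εstar ∧ ∀ ε : ℝ, 0 < ε → ε < εstar →
      ∀ (x₀ : E) (τ₀ : ℝ), 0 ≤ τ₀ →
        ∀ (T : EReal) (x : ℝ → E) (τ : ℝ → ℝ), IsSolution (f ε) ε x₀ τ₀ T x τ →
          (∀ t ∈ timeDomain T, ‖x t‖ ≤ β ‖x₀‖ t + ν) ∧
          (IsMaximalSolution (f ε) ε x₀ τ₀ T x τ → T = ⊤)

end Systems

/-- The bounded feedback law: the components `j = 0, 1` are
`√(2ω) cos (y + ωτ)` and `√(2ω) sin (y + ωτ)`. -/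
def boundedFeedback (ω : ℝ) (j : Fin 2) (y τ : ℝ) : ℝ :=
  ![Real.sqrt (2 * ω) * Real.cos (y + ω * τ), Real.sqrt (2 * ω) * Real.sin (y + ω * τ)] j

/-- The right-hand side of the closed-loop system in the shifted coordinate `z = x - xstar`:
`b₀ (z + xstar) + ε⁻¹ ∑ᵢ ∑ⱼ uᵢⱼ (J (z + xstar), τ) bᵢⱼ`. -/
def esField {n r : ℕ} (J : EuclideanSpace ℝ (Fin n) → ℝ)
    (b₀ : EuclideanSpace ℝ (Fin n) → EuclideanSpace ℝ (Fin n))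
    (b : Fin r → Fin 2 → EuclideanSpace ℝ (Fin n)) (ω : Fin r → ℚ)
    (xstar : EuclideanSpace ℝ (Fin n)) (ε : ℝ) (z : EuclideanSpace ℝ (Fin n)) (τ : ℝ) :
    EuclideanSpace ℝ (Fin n) :=
  b₀ (z + xstar) +
    ε⁻¹ • ∑ i : Fin r, ∑ j : Fin 2, boundedFeedback (ω i : ℝ) j (J (z + xstar)) τ • b i j

end

/-! Up to quarter-period shifts every input is `√(2w) cos (J + wτ - c)`, so differentiating its
phase brings in `∇J`. Integrating the fast terms along an arbitrary trajectory produces products of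
two cosines; their means vanish for different channels and equal `1/2` for equal ones. Two explicit
correctors thus turn `X` into an `O(ε)`-close curve `Y` following `Y' = b₀ - ∑ ⟪b, ∇J⟫ b` up to
`O(ε)` (`exists_near_identity_averaging`). The bounds on `b₀`, `∇J` and the Hessian are global, so
the error does not depend on the trajectory, its length or its starting point.

By the spanning and drift conditions, `J` decreases along `Y` at rate at least `(γ - κ₃)‖∇J‖²` minus
`O(ε)‖∇J‖`. With `V = J - J xstar` this gives `V' ≤ -ρ V` above a small level, for a nondecreasing
`ρ`. Hence `V T + T ρ (V T) ≤ V 0`, and inverting this inequality yields the `KL` bound without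
solving a comparison ODE (`exists_isClassKL_of_approx_descent`).

Completeness is separate: for fixed `ε` the field is bounded and globally Lipschitz. -/

/-! ### Comparison functions and a decay estimate -/

/-- A family of class `K∞` functions `Φ · t` that grows strictly and without bound in the parameter
`t` has a class `KL` inverse. -/
theorem exists_isClassKL_inverse (Φ : ℝ → ℝ → ℝ)
    (hK : ∀ t, 0 ≤ t → IsClassKInfty (fun s => Φ s t))
    (hc : ∀ s, 0 ≤ s → ContinuousOn (Φ s) (Ici 0))
    (hm : ∀ s, 0 < s → StrictMonoOn (Φ s) (Ici 0))
    (hlim : ∀ s, 0 < s → Tendsto (Φ s) atTop atTop) :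
    ∃ β, IsClassKL β ∧ ∀ r s t, 0 ≤ r → 0 ≤ s → 0 ≤ t → Φ s t ≤ r → s ≤ β r t := by
  have ex : ∀ r t, ∃ s, 0 ≤ r → 0 ≤ t → 0 ≤ s ∧ Φ s t = r := by
    intro r t
    by_cases h : 0 ≤ r ∧ 0 ≤ t
    · obtain ⟨A, hA0, hA⟩ := (((hK t h.2).tendsto_atTop.eventually_ge_atTop r).and
        (eventually_ge_atTop 0)).exists.imp fun A hA => And.intro hA.2 hA.1
      have := intermediate_value_Icc hA0 ((hK t h.2).continuousOn.mono Icc_subset_Ici_self)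
      obtain ⟨s, hs, hsr⟩ := this ⟨by simpa [(hK t h.2).map_zero] using h.1, hA⟩
      exact ⟨s, fun _ _ => ⟨hs.1, hsr⟩⟩
    · exact ⟨0, fun h1 h2 => absurd ⟨h1, h2⟩ h⟩
  choose β hβ using ex
  -- Together with `gt_iff`, this makes each one-sided bound on `β` at a fixed level `s` a strict
  -- inequality between `Φ s t` and `r`. Joint continuity of `β` then needs only continuity of `Φ s`
  -- in `t`.
  have lt_iff : ∀ r s t, 0 ≤ r → 0 ≤ s → 0 ≤ t → (Φ s t < r ↔ s < β r t) := by
    intro r s t hr hs ht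
    obtain ⟨h0, h1⟩ := hβ r t hr ht
    have := (hK t ht).strictMonoOn.lt_iff_lt (mem_Ici.2 hs) (mem_Ici.2 h0)
    simp only [h1] at this
    exact this
  have gt_iff : ∀ r s t, 0 ≤ r → 0 ≤ s → 0 ≤ t → (r < Φ s t ↔ β r t < s) := by
    intro r s t hr hs ht
    obtain ⟨h0, h1⟩ := hβ r t hr ht
    have := (hK t ht).strictMonoOn.lt_iff_lt (mem_Ici.2 h0) (mem_Ici.2 hs)
    simp only [h1] at this
    exact this
  have cont : ContinuousOn (fun p : ℝ × ℝ => β p.1 p.2) (Ici 0 ×ˢ Ici 0) := by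
    rintro ⟨r, t⟩ ⟨hr, ht⟩
    simp only [mem_Ici] at hr ht
    have hfst : Tendsto (fun p : ℝ × ℝ => p.1) (𝓝[Ici 0 ×ˢ Ici 0] (r, t)) (𝓝 r) :=
      continuous_fst.continuousAt.mono_left nhdsWithin_le_nhds
    have hsnd : ∀ s, 0 ≤ s → Tendsto (fun p : ℝ × ℝ => Φ s p.2) (𝓝[Ici 0 ×ˢ Ici 0] (r, t))
        (𝓝 (Φ s t)) := by
      intro s hs
      have h1 : ContinuousWithinAt (fun p : ℝ × ℝ => Φ s p.2) (Ici 0 ×ˢ Ici 0) (r, t) :=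
        ContinuousWithinAt.comp (g := Φ s) (f := Prod.snd) (t := Ici 0) (hc s hs t ht)
          continuous_snd.continuousWithinAt (fun p hp => hp.2)
      exact h1
    refine tendsto_order.2 ⟨fun s hs => ?_, fun s hs => ?_⟩
    · rcases lt_or_ge s 0 with h | h
      · filter_upwards [self_mem_nhdsWithin] with p hp
        exact h.trans_le (hβ _ _ hp.1 hp.2).1
      · filter_upwards [self_mem_nhdsWithin,
          (hsnd s h).eventually_lt hfst ((lt_iff _ _ _ hr h ht).2 hs)] with p hp h2
        exact (lt_iff _ _ _ hp.1 h hp.2).1 h2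
    · have h : 0 ≤ s := (hβ r t hr ht).1.trans hs.le
      filter_upwards [self_mem_nhdsWithin,
          hfst.eventually_lt (hsnd s h) ((gt_iff _ _ _ hr h ht).2 hs)] with p hp h2
      exact (gt_iff _ _ _ hp.1 h hp.2).1 h2
  have zero : ∀ t, 0 ≤ t → β 0 t = 0 := by
    intro t ht
    obtain ⟨h0, h1⟩ := hβ 0 t le_rfl ht
    refine ((hK t ht).strictMonoOn.injOn (mem_Ici.2 h0) (mem_Ici.2 le_rfl) ?_)
    simp [h1, (hK t ht).map_zero]
  refine ⟨β, ⟨cont, fun t ht => ⟨⟨?_, ?_, zero t ht⟩, ?_⟩, ?_, ?_⟩, ?_⟩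
  · exact cont.comp (f := fun r => (r, t)) (by fun_prop) (fun r hr => ⟨hr, ht⟩)
  · intro r hr r' hr' h
    refine (lt_iff _ _ _ hr' (hβ r t hr ht).1 ht).1 ?_
    rw [(hβ r t hr ht).2]
    exact h
  · refine tendsto_atTop.2 fun A => ?_
    filter_upwards [eventually_gt_atTop (Φ (max A 0) t), eventually_ge_atTop 0] with r h1 h2
    exact (le_max_left A 0).trans ((lt_iff _ _ _ h2 (le_max_right _ _) ht).1 h1).le
  · intro r hr t ht t' ht' h
    have h0 : 0 < β r t := (lt_iff _ _ _ hr.le le_rfl ht).1 (by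
      rw [(hK t ht).map_zero]; exact hr)
    refine (gt_iff _ _ _ hr.le h0.le ht').1 ?_
    have := hm _ h0 ht ht' h
    rwa [(hβ r t hr.le ht).2] at this
  · intro r hr
    refine tendsto_order.2 ⟨fun s hs => ?_, fun s hs => ?_⟩
    · filter_upwards [eventually_ge_atTop 0] with t ht
      exact hs.trans_le (hβ r t hr ht).1
    · filter_upwards [eventually_ge_atTop 0, (hlim s hs).eventually_gt_atTop r] with t ht h
      exact (gt_iff _ _ _ hr hs.le ht).1 h
  · intro r s t hr hs ht h
    by_contra! h'
    exact absurd ((gt_iff _ _ _ hr hs ht).2 h') (not_lt.2 h)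

/-- If `v` decreases at rate at least `ρ v` as long as `m ≤ v`, then `v b + b * ρ (v b) ≤ v 0`
whenever `m < v b`. -/
theorem add_mul_le_of_deriv_le {v v' ρ : ℝ → ℝ} {m b : ℝ} (hb : 0 ≤ b)
    (hρ : MonotoneOn ρ (Ici 0)) (hρ0 : ∀ s, 0 ≤ s → 0 ≤ ρ s) (hm : 0 ≤ m)
    (hv : ∀ t ∈ Icc 0 b, HasDerivWithinAt v (v' t) (Icc 0 b) t)
    (hdecay : ∀ t ∈ Icc 0 b, m ≤ v t → v' t ≤ -ρ (v t)) (hmb : m < v b) :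
    v b + b * ρ (v b) ≤ v 0 := by
  have hcont : ContinuousOn v (Icc 0 b) := fun t ht => (hv t ht).continuousWithinAt
  have anti : ∀ a ∈ Icc 0 b, (∀ t ∈ Ioo a b, m ≤ v t) → AntitoneOn v (Icc a b) := by
    intro a ha h
    have hsub : Icc a b ⊆ Icc 0 b := Icc_subset_Icc_left ha.1
    refine antitoneOn_of_hasDerivWithinAt_nonpos (convex_Icc a b) (hcont.mono hsub)
      (f' := v') (fun t ht => (hv t (hsub (interior_subset ht))).mono
        (interior_subset.trans hsub)) (fun t ht => ?_)
    rw [interior_Icc] at ht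
    have hmt := h t ht
    have := hdecay t (hsub (Ioo_subset_Icc_self ht)) hmt
    linarith [hρ0 (v t) (hm.trans hmt)]
  -- After the last time `a` with `v a ≤ m`, `v` is nonincreasing, so `v b ≤ m`, a contradiction.
  have above : ∀ t ∈ Icc 0 b, m < v t := by
    by_contra! hcon
    obtain ⟨t₀, ht₀, hle⟩ := hcon
    have hclosed : IsCompact (Icc 0 b ∩ v ⁻¹' Iic m) :=
      isCompact_Icc.of_isClosed_subset
        (hcont.preimage_isClosed_of_isClosed isClosed_Icc isClosed_Iic) inter_subset_left
    obtain ⟨a, ha, hmax⟩ := hclosed.exists_isGreatest ⟨t₀, ht₀, hle⟩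
    have hge : ∀ t ∈ Ioo a b, m ≤ v t := by
      intro t ht
      by_contra! hlt
      have := hmax ⟨⟨ha.1.1.trans ht.1.le, ht.2.le⟩, hlt.le⟩
      exact absurd ht.1 (not_lt.2 this)
    have := anti a ha.1 hge (left_mem_Icc.2 ha.1.2) (right_mem_Icc.2 ha.1.2) ha.1.2
    have h2 : v a ≤ m := ha.2
    linarith
  have hb0 : (0 : ℝ) ∈ Icc 0 b := left_mem_Icc.2 hb
  have hbb : b ∈ Icc 0 b := right_mem_Icc.2 hb
  have hanti := anti 0 hb0 (fun t ht => (above t (Ioo_subset_Icc_self ht)).le)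
  -- Since `v t ≥ v b` and `ρ` is monotone, the varying rate `ρ (v t)` may be replaced by the
  -- constant `ρ (v b)`.
  have key : AntitoneOn (fun t => v t + t * ρ (v b)) (Icc 0 b) := by
    refine antitoneOn_of_hasDerivWithinAt_nonpos (convex_Icc 0 b) (by fun_prop)
      (f' := fun t => v' t + 1 * ρ (v b)) (fun t ht => ?_) (fun t ht => ?_)
    · exact ((hv t (interior_subset ht)).mono interior_subset).add
        ((hasDerivWithinAt_id _ _).mul_const _)
    · have ht' := interior_subset ht
      have h1 := hdecay t ht' (above t ht').le
      have h2 : ρ (v b) ≤ ρ (v t) := hρ (hm.trans (above b hbb).le) (hm.trans (above t ht').le)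
        (hanti ht' hbb ht'.2)
      linarith
  simpa using key hb0 hbb hb

/-- A continuous positive definite radially unbounded function dominates a class `K∞` function of
the norm. -/
theorem exists_isClassKInfty_le {E : Type*} [NormedAddCommGroup E] {V : E → ℝ}
    (hV : Continuous V) (hV0 : ∀ x, 0 ≤ V x) (hVpos : ∀ x, x ≠ 0 → 0 < V x)
    (hVtop : Tendsto V (cocompact E) atTop) :
    ∃ α, IsClassKInfty α ∧ ∀ x, α ‖x‖ ≤ V x := by
  -- Penalising `‖x‖ < s` with slope one makes the infimum 1-Lipschitz in `s`, hence continuous, and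
  -- keeps it monotone; the penalty vanishes at `s = ‖x‖`.
  set f : ℝ → ℝ := fun s => ⨅ x, (V x + max 0 (s - ‖x‖)) with hf
  have bdd : ∀ s, BddBelow (range fun x => V x + max 0 (s - ‖x‖)) := fun s =>
    ⟨0, by rintro _ ⟨x, rfl⟩; exact add_nonneg (hV0 x) (le_max_left _ _)⟩
  have fle : ∀ s x, f s ≤ V x + max 0 (s - ‖x‖) := fun s x => ciInf_le (bdd s) x
  have lef : ∀ s A, (∀ x, A ≤ V x + max 0 (s - ‖x‖)) → A ≤ f s := fun s A h => le_ciInf h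
  have fmono : Monotone f := fun s s' h => lef _ _ fun x => (fle s x).trans (by gcongr)
  have flip : LipschitzWith 1 f := by
    refine LipschitzWith.of_le_add fun s s' => ?_
    have : f s - dist s s' ≤ f s' := lef _ _ fun x => by
      have h1 := fle s x
      have h2 : max 0 (s - ‖x‖) ≤ max 0 (s' - ‖x‖) + dist s s' := by
        have := le_abs_self (s - s')
        rw [Real.dist_eq]
        refine max_le (by positivity) ?_
        linarith [le_max_right 0 (s' - ‖x‖)]
      linarith
    linarith
  have fpos : ∀ s, 0 < s → 0 < f s := by
    intro s hs
    have : ∃ δ > 0, ∀ x, s / 2 ≤ ‖x‖ → δ ≤ V x := by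
      -- The region away from the origin is empty when `E` is trivial.
      by_cases hne : ∃ x₀ : E, s / 2 ≤ ‖x₀‖
      · obtain ⟨x₀, hx₀⟩ := hne
        obtain ⟨x, hx, hmin⟩ := hV.continuousOn.exists_isMinOn' (s := {x : E | s / 2 ≤ ‖x‖})
          (isClosed_le continuous_const continuous_norm) hx₀
          ((hVtop.eventually_ge_atTop (V x₀)).filter_mono inf_le_left)
        refine ⟨V x, hVpos x ?_, fun y hy => hmin hy⟩
        rintro rfl
        simp only [mem_ofPred_eq, norm_zero] at hx
        linarith
      · push Not at hne
        exact ⟨1, one_pos, fun x hx => absurd (hne x) (not_lt.2 hx)⟩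
    obtain ⟨δ, hδ, hδV⟩ := this
    refine (lt_min hδ (half_pos hs)).trans_le (lef _ _ fun x => ?_)
    rcases le_or_gt (s / 2) ‖x‖ with h | h
    · linarith [min_le_left δ (s / 2), hδV x h, le_max_left 0 (s - ‖x‖)]
    · linarith [min_le_right δ (s / 2), hV0 x, le_max_right 0 (s - ‖x‖)]
  have ftop : Tendsto f atTop atTop := by
    refine tendsto_atTop.2 fun A => ?_
    have h1 : ∀ᶠ x in Bornology.cobounded E, A ≤ V x :=
      (hVtop.eventually_ge_atTop A).filter_mono Metric.cobounded_le_cocompact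
    obtain ⟨R, -, hR⟩ := (hasBasis_cobounded_norm (E := E)).eventually_iff.1 h1
    filter_upwards [eventually_ge_atTop (R + A)] with s hs
    refine lef _ _ fun x => ?_
    rcases le_or_gt R ‖x‖ with h | h
    · linarith [hR h, le_max_left 0 (s - ‖x‖)]
    · linarith [hV0 x, le_max_right 0 (s - ‖x‖)]
  have qmono : StrictMonoOn (fun s : ℝ => s / (1 + s)) (Ici 0) := by
    intro s hs s' hs' h
    simp only [mem_Ici] at hs hs'
    change s / (1 + s) < s' / (1 + s')
    rw [div_lt_div_iff₀ (by linarith) (by linarith)]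
    linarith
  have f0 : 0 ≤ f 0 := lef _ _ fun x => add_nonneg (hV0 x) (le_max_left _ _)
  have fnn : ∀ s, 0 ≤ s → 0 ≤ f s := fun s hs => f0.trans (fmono hs)
  -- The factor forces the value zero at zero and strict growth; it is at most `1`, and at least
  -- `1/2` for `s ≥ 1`.
  refine ⟨fun s => f s * (s / (1 + s)), ⟨⟨?_, ?_, by simp⟩, ?_⟩, fun x => ?_⟩
  · refine flip.continuous.continuousOn.mul (ContinuousOn.div (by fun_prop) (by fun_prop) ?_)
    intro s hs
    simp only [mem_Ici] at hs
    linarith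
  · intro s hs s' hs' h
    have hs0 : (0 : ℝ) ≤ s := hs
    have hq := qmono hs hs' h
    simp only at hq
    have hq0 : 0 ≤ s / (1 + s) := by positivity
    exact mul_lt_mul' (fmono h.le) hq hq0 (fpos s' (hs0.trans_lt h))
  · refine tendsto_atTop_mono' atTop ?_ (ftop.atTop_mul_const (r := 1 / 2) (by norm_num))
    filter_upwards [eventually_ge_atTop 1] with s hs
    refine mul_le_mul_of_nonneg_left ?_ (fnn s (by linarith))
    rw [div_le_div_iff₀ (by norm_num) (by linarith)]
    linarith
  · have h1 := fle ‖x‖ x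
    simp only [sub_self, max_self, add_zero] at h1
    refine le_trans ?_ h1
    refine mul_le_of_le_one_right (fnn _ (norm_nonneg x)) ?_
    rw [div_le_one (by positivity)]
    linarith

/-! ### Averaging along trajectories -/

section Averaging

variable {E : Type*} [NormedAddCommGroup E] [InnerProductSpace ℝ E]
  {ι : Type*} [Fintype ι]

/-- The antiderivative of `cos φₚ * cos φ_q` along the fast phases `φₚ`, `φ_q` of frequencies `v`
and `w`, with its mean removed. For `v = w` the second term vanishes. -/
noncomputable def cosMulPrimitive (v w φ ψ : ℝ) : ℝ :=
  (Real.sin (φ + ψ) / (v + w) + Real.sin (φ - ψ) / (v - w)) / 2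

theorem abs_cosMulPrimitive_le (v w φ ψ : ℝ) :
    |cosMulPrimitive v w φ ψ| ≤ (1 / |v + w| + 1 / |v - w|) / 2 := by
  rw [cosMulPrimitive, abs_div, abs_two]
  gcongr
  refine (abs_add_le _ _).trans ?_
  rw [abs_div, abs_div]
  gcongr <;> exact Real.abs_sin_le_one _

/-- Derivative of `cosMulPrimitive` along phases `φ`, `ψ` with derivatives `d + v * e`,
`d + w * e`. Here `δ` is the mean of `2 cos φ cos ψ`. -/
theorem hasDerivWithinAt_cosMulPrimitive {φ ψ : ℝ → ℝ} {s : Set ℝ} {t v w d e δ : ℝ}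
    (hv : 0 < v) (hw : 0 < w)
    (hφ : HasDerivWithinAt φ (d + v * e) s t) (hψ : HasDerivWithinAt ψ (d + w * e) s t)
    (hne : v ≠ w → δ = 0) (heq : v = w → Real.cos (φ t - ψ t) = δ) :
    HasDerivWithinAt (fun u => cosMulPrimitive v w (φ u) (ψ u))
      (e * (Real.cos (φ t) * Real.cos (ψ t) - δ / 2)
        + Real.cos (φ t + ψ t) / (v + w) * d) s t := by
  have h := (((hφ.add hψ).sin.div_const (v + w)).add
    ((hφ.sub hψ).sin.div_const (v - w))).div_const 2
  refine h.congr_deriv ?_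
  have hc : Real.cos (φ t) * Real.cos (ψ t)
      = (Real.cos (φ t + ψ t) + Real.cos (φ t - ψ t)) / 2 := by
    rw [Real.cos_add, Real.cos_sub]; ring
  have hvw : v + w ≠ 0 := by positivity
  simp only [Pi.add_apply, Pi.sub_apply]
  rw [hc]
  -- The common drift `d` cancels in `φ - ψ`, so only the sum phase leaves a remainder. If `v = w`,
  -- division by zero gives `0`, and the resonant term `cos (φ - ψ) = δ` is exactly the mean to
  -- subtract.
  by_cases hcase : v = w
  · rw [heq hcase]
    subst hcase
    simp only [sub_self, div_zero]
    field_simp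
    ring
  · have : v - w ≠ 0 := sub_ne_zero.2 hcase
    rw [hne hcase]
    field_simp
    ring

variable [CompleteSpace E]

/-- Near-identity averaging transformation: along trajectories of
`X' = b₀ X + ε⁻¹ ∑ₚ √(2 wₚ) cos (J X + wₚ τ - cₚ) bₚ`, `τ' = ε⁻²`, there is a curve that stays
`O(ε)`-close to `X` and solves the averaged system `Y' = b₀ Y - ∑ₚ ⟪bₚ, ∇J Y⟫ bₚ` up to an error
`O(ε)`, uniformly in the trajectory. -/
theorem exists_near_identity_averaging [DecidableEq ι] (J : E → ℝ) (b₀ : E → E) (b : ι → E)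
    (w c : ι → ℝ) (hw : ∀ p, 0 < w p)
    (hwc : ∀ p q, w p = w q → Real.cos (c q - c p) = if p = q then 1 else 0)
    (hJ : ContDiff ℝ 2 J) {L M κ L₀ : ℝ} (hL : 0 ≤ L) (hM : 0 ≤ M) (hκ : 0 ≤ κ) (hL₀ : 0 ≤ L₀)
    (hhess : ∀ x, ‖fderiv ℝ (gradient J) x‖ ≤ L) (hgrad : ∀ x, ‖gradient J x‖ ≤ M)
    (hb₀ : ∀ x, ‖b₀ x‖ ≤ κ) (hlip : ∀ x y, ‖b₀ x - b₀ y‖ ≤ L₀ * ‖x - y‖) :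
    ∃ C, 0 ≤ C ∧ ∀ ε, 0 < ε → ε ≤ 1 → ∀ (s : Set ℝ) (X : ℝ → E) (τ : ℝ → ℝ),
      (∀ t ∈ s, HasDerivWithinAt X (b₀ (X t) + ε⁻¹ • ∑ p, (Real.sqrt (2 * w p) *
        Real.cos (J (X t) + w p * τ t - c p)) • b p) s t) →
      (∀ t ∈ s, HasDerivWithinAt τ ((ε ^ 2)⁻¹) s t) →
      ∃ Y Y' : ℝ → E, (∀ t ∈ s, HasDerivWithinAt Y (Y' t) s t) ∧
        (∀ t, ‖Y t - X t‖ ≤ C * ε) ∧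
        ∀ t ∈ s, ‖Y' t - (b₀ (Y t) - ∑ p, inner ℝ (b p) (gradient J (Y t)) • b p)‖ ≤ C * ε := by
  set a : ι → ℝ := fun p => Real.sqrt (2 * w p) with ha
  -- Coefficient of `cos φₚ cos φ_q` created by differentiating the first corrector. The amplitude
  -- `√(2w)` makes `k p p = 2`, which cancels the mean `1/2`.
  set k : ι → ι → ℝ := fun p q => a p * a q / w p with hk
  have ha2 : ∀ p, a p * a p = 2 * w p := fun p => Real.mul_self_sqrt (by have := hw p; positivity)
  have ha0 : ∀ p, 0 ≤ a p := fun p => Real.sqrt_nonneg _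
  have hk0 : ∀ p q, 0 ≤ k p q := fun p q =>
    div_nonneg (mul_nonneg (ha0 p) (ha0 q)) (hw p).le
  have hkp : ∀ p, k p p = 2 := fun p => by
    simp only [hk, ha2]; have := (hw p).ne'; field_simp
  have hg1 : ContDiff ℝ 1 (gradient J) := by
    have : gradient J = fun x => (InnerProductSpace.toDual ℝ E).symm (fderiv ℝ J x) := rfl
    rw [this]
    exact (InnerProductSpace.toDual ℝ E).symm.contDiff.comp
      (hJ.fderiv_right (by norm_num))
  have hgd : Differentiable ℝ (gradient J) := hg1.differentiable (by norm_num)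
  have hJd : Differentiable ℝ J := hJ.differentiable (by norm_num)
  have hglip : ∀ x y, ‖gradient J x - gradient J y‖ ≤ L * ‖x - y‖ := fun x y =>
    convex_univ.norm_image_sub_le_of_norm_fderiv_le (fun z _ => hgd z) (fun z _ => hhess z)
      (mem_univ y) (mem_univ x)
  -- Bound for `ε X'` when `ε ≤ 1`.
  set D : ℝ := κ + ∑ p, a p * ‖b p‖ with hD
  have hD0 : 0 ≤ D := by have := ha0; positivity
  set π : ι → ι → ℝ := fun p q => (1 / |w p + w q| + 1 / |w p - w q|) / 2 with hπ
  have hπ0 : ∀ p q, 0 ≤ π p q := fun p q => by positivity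
  -- bounds of the two correction terms and of the remainder
  set C₁ : ℝ := ∑ p, (a p / w p) * ‖b p‖ with hC₁
  set C₂ : ℝ := ∑ p, (∑ q, k p q * π p q * (‖b q‖ * M)) * ‖b p‖ with hC₂
  set C₃ : ℝ := ∑ p, (a p / w p * (M * κ) + ∑ q, k p q *
    (1 / (w p + w q) * (M * D) * (‖b q‖ * M) + π p q * (‖b q‖ * (L * D)))) * ‖b p‖ with hC₃
  -- Lipschitz constant of the averaged field, used to move its argument from `X` to `Y`.
  set N : ℝ := L₀ + ∑ p, ‖b p‖ * L * ‖b p‖ with hN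
  have hC₁0 : 0 ≤ C₁ := Finset.sum_nonneg fun p _ =>
    mul_nonneg (div_nonneg (ha0 p) (hw p).le) (norm_nonneg _)
  have hC₂0 : 0 ≤ C₂ := Finset.sum_nonneg fun p _ => mul_nonneg (Finset.sum_nonneg fun q _ =>
    mul_nonneg (mul_nonneg (hk0 p q) (hπ0 p q)) (by positivity)) (norm_nonneg _)
  have hC₃0 : 0 ≤ C₃ := Finset.sum_nonneg fun p _ => by
    refine mul_nonneg (add_nonneg (mul_nonneg (div_nonneg (ha0 p) (hw p).le) (by positivity))
      (Finset.sum_nonneg fun q _ => mul_nonneg (hk0 p q) ?_)) (norm_nonneg _)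
    have := hw p
    have := hw q
    have := hπ0 p q
    positivity
  have hN0 : 0 ≤ N := by positivity
  refine ⟨(C₁ + C₂) + (C₃ + N * (C₁ + C₂)), by positivity, ?_⟩
  intro ε hε hε1 s X τ hX hτ
  set φ : ι → ℝ → ℝ := fun p t => J (X t) + w p * τ t - c p with hφ
  set X' : ℝ → E := fun t => b₀ (X t) + ε⁻¹ • ∑ p, (a p * Real.cos (φ p t)) • b p with hX'
  set g : ℝ → E := fun t => gradient J (X t) with hg
  set P : ι → ι → ℝ → ℝ := fun p q t => cosMulPrimitive (w p) (w q) (φ p t) (φ q t) with hP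
  -- The `ε` term integrates the `ε⁻¹` oscillation; the `ε²` term integrates the order-one products
  -- it leaves, with their means removed.
  set coef : ι → ℝ → ℝ := fun p t => -(ε * (a p / w p * Real.sin (φ p t)))
    + ε ^ 2 * ∑ q, k p q * (P p q t * inner ℝ (b q) (g t)) with hcoef
  set U : ℝ → E := fun t => ε • X' t with hU
  set Z : ι → ℝ → ℝ := fun p t =>
    ∑ q, k p q * (Real.cos (φ p t + φ q t) / (w p + w q) * inner ℝ (g t) (U t)
      * inner ℝ (b q) (g t) + P p q t * inner ℝ (b q) (fderiv ℝ (gradient J) (X t) (U t))) with hZ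
  set R : ι → ℝ → ℝ := fun p t => -(a p / w p * Real.cos (φ p t) * inner ℝ (g t) (b₀ (X t)))
    + Z p t with hR
  have hUeq : ∀ t, U t = ε • b₀ (X t) + ∑ p, (a p * Real.cos (φ p t)) • b p := fun t => by
    simp only [hU, hX', smul_add, smul_smul, mul_inv_cancel₀ hε.ne', one_smul]
  have hUle : ∀ t, ‖U t‖ ≤ D := fun t => by
    rw [hUeq]
    refine (norm_add_le _ _).trans (add_le_add ?_ ((norm_sum_le _ _).trans
      (Finset.sum_le_sum fun p _ => ?_)))
    · rw [norm_smul, Real.norm_of_nonneg hε.le]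
      exact (mul_le_of_le_one_left (norm_nonneg _) hε1).trans (hb₀ _)
    · rw [norm_smul, norm_mul, Real.norm_of_nonneg (ha0 p)]
      gcongr
      exact mul_le_of_le_one_right (ha0 p) (Real.abs_cos_le_one _)
  have hφd : ∀ p, ∀ t ∈ s, HasDerivWithinAt (φ p)
      (inner ℝ (g t) (X' t) + w p * (ε ^ 2)⁻¹) s t := fun p t ht => by
    have h1 : HasDerivWithinAt (fun t => J (X t)) (inner ℝ (g t) (X' t)) s t := by
      have := (hJd (X t)).hasFDerivAt.comp_hasDerivWithinAt t (hX t ht)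
      rwa [← inner_gradient_left] at this
    exact (h1.add ((hτ t ht).const_mul (w p))).sub_const (c p)
  have hPd : ∀ p q, ∀ t ∈ s, HasDerivWithinAt (P p q)
      ((ε ^ 2)⁻¹ * (Real.cos (φ p t) * Real.cos (φ q t) - (if p = q then 1 else 0) / 2)
        + Real.cos (φ p t + φ q t) / (w p + w q) * inner ℝ (g t) (X' t)) s t := fun p q t ht => by
    refine hasDerivWithinAt_cosMulPrimitive (hw p) (hw q) (hφd p t ht) (hφd q t ht) ?_ ?_
    · intro hne
      rw [if_neg]
      rintro rfl
      exact hne rfl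
    · intro heq
      rw [← hwc p q heq]
      congr 1
      simp only [hφ, heq]
      ring
  have hbg : ∀ q, ∀ t ∈ s, HasDerivWithinAt (fun t => inner ℝ (b q) (g t))
      (inner ℝ (b q) (fderiv ℝ (gradient J) (X t) (X' t))) s t := fun q t ht => by
    have h1 : HasDerivWithinAt g (fderiv ℝ (gradient J) (X t) (X' t)) s t :=
      (hgd (X t)).hasFDerivAt.comp_hasDerivWithinAt t (hX t ht)
    simpa using (hasDerivWithinAt_const t s (b q)).inner ℝ h1
  -- The first summand cancels the fast input, the second is the averaged field, and the rest is
  -- `O(ε)`.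
  have hcoefd : ∀ p, ∀ t ∈ s, HasDerivWithinAt (coef p)
      (-(ε⁻¹ * (a p * Real.cos (φ p t))) - inner ℝ (b p) (g t) + ε * R p t) s t := by
    intro p t ht
    have h1 := (((hφd p t ht).sin.const_mul (a p / w p)).const_mul ε).neg
    have h2 := (HasDerivWithinAt.fun_sum (u := Finset.univ) fun q _ =>
      ((hPd p q t ht).mul (hbg q t ht)).const_mul (k p q)).const_mul (ε ^ 2)
    refine (h1.add h2).congr_deriv ?_
    have e1 : inner ℝ (g t) (X' t) = inner ℝ (g t) (b₀ (X t))
        + ε⁻¹ * ∑ q, a q * Real.cos (φ q t) * inner ℝ (b q) (g t) := by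
      simp only [hX', inner_add_right, inner_smul_right, inner_sum]
      simp only [real_inner_comm (g t)]
    have e2 : ∑ q, k p q * ((if p = q then (1 : ℝ) else 0) / 2 * inner ℝ (b q) (g t))
        = inner ℝ (b p) (g t) := by
      rw [Finset.sum_eq_single p]
      · simp [hkp]
      · intro q _ hq
        simp [hq.symm]
      · simp
    have e3 : ∑ q, k p q * (Real.cos (φ p t) * Real.cos (φ q t) * inner ℝ (b q) (g t))
        = a p / w p * Real.cos (φ p t)
          * ∑ q, a q * Real.cos (φ q t) * inner ℝ (b q) (g t) := by
      rw [Finset.mul_sum]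
      refine Finset.sum_congr rfl fun q _ => ?_
      simp only [hk]
      ring
    -- Phases run at rate `ε⁻²`, which `ε²` normalises; every other contribution carries `ε² X' = ε
    -- U` with `U` bounded.
    have e4 : ε ^ 2 * ∑ q, k p q * (((ε ^ 2)⁻¹ * (Real.cos (φ p t) * Real.cos (φ q t)
          - (if p = q then 1 else 0) / 2)
          + Real.cos (φ p t + φ q t) / (w p + w q) * inner ℝ (g t) (X' t))
            * inner ℝ (b q) (g t)
          + P p q t * inner ℝ (b q) (fderiv ℝ (gradient J) (X t) (X' t)))
        = ∑ q, k p q * (Real.cos (φ p t) * Real.cos (φ q t) * inner ℝ (b q) (g t))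
          - ∑ q, k p q * ((if p = q then (1 : ℝ) else 0) / 2 * inner ℝ (b q) (g t))
          + ε * Z p t := by
      simp only [hZ, Finset.mul_sum, ← Finset.sum_sub_distrib, ← Finset.sum_add_distrib]
      refine Finset.sum_congr rfl fun q _ => ?_
      simp only [hU, map_smul, inner_smul_right]
      field_simp
      ring
    rw [e4, e2, e3, e1]
    simp only [hR]
    have := (hw p).ne'
    field_simp
    ring
  have hYX : ∀ t, ‖∑ p, coef p t • b p‖ ≤ (C₁ + C₂) * ε := by
    intro t
    rw [hC₁, hC₂, ← Finset.sum_add_distrib, Finset.sum_mul]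
    refine (norm_sum_le _ _).trans (Finset.sum_le_sum fun p _ => ?_)
    rw [norm_smul, ← add_mul, mul_right_comm]
    refine mul_le_mul_of_nonneg_right ?_ (norm_nonneg _)
    have h1 : |ε * (a p / w p * Real.sin (φ p t))| ≤ a p / w p * ε := by
      rw [abs_mul, abs_mul, abs_of_pos hε, abs_of_nonneg (div_nonneg (ha0 p) (hw p).le), mul_comm]
      exact mul_le_mul_of_nonneg_right (mul_le_of_le_one_right
        (div_nonneg (ha0 p) (hw p).le) (Real.abs_sin_le_one _)) hε.le
    have h2 : |∑ q, k p q * (P p q t * inner ℝ (b q) (g t))|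
        ≤ ∑ q, k p q * π p q * (‖b q‖ * M) := by
      refine (Finset.abs_sum_le_sum_abs _ _).trans (Finset.sum_le_sum fun q _ => ?_)
      rw [abs_mul, abs_mul, abs_of_nonneg (hk0 p q), mul_assoc]
      refine mul_le_mul_of_nonneg_left ?_ (hk0 p q)
      exact mul_le_mul (abs_cosMulPrimitive_le _ _ _ _)
        ((abs_real_inner_le_norm _ _).trans (by gcongr; exact hgrad _)) (abs_nonneg _) (hπ0 p q)
    have h3 : ε ^ 2 ≤ ε := by nlinarith
    have h4 : 0 ≤ ∑ q, k p q * π p q * (‖b q‖ * M) := (abs_nonneg _).trans h2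
    calc |coef p t| ≤ |ε * (a p / w p * Real.sin (φ p t))|
          + |ε ^ 2 * ∑ q, k p q * (P p q t * inner ℝ (b q) (g t))| :=
          (abs_add_le _ _).trans (by rw [abs_neg])
      _ ≤ a p / w p * ε + ε * ∑ q, k p q * π p q * (‖b q‖ * M) := by
          refine add_le_add h1 ?_
          rw [abs_mul, abs_of_nonneg (sq_nonneg ε)]
          exact mul_le_mul h3 h2 (abs_nonneg _) hε.le
      _ = _ := by ring
  have hRle : ∀ p t, |R p t| ≤ a p / w p * (M * κ) + ∑ q, k p q *
      (1 / (w p + w q) * (M * D) * (‖b q‖ * M) + π p q * (‖b q‖ * (L * D))) := by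
    intro p t
    have hbM : ∀ q, |inner ℝ (b q) (g t)| ≤ ‖b q‖ * M := fun q =>
      (abs_real_inner_le_norm _ _).trans (by gcongr; exact hgrad _)
    refine (abs_add_le _ _).trans (add_le_add ?_ ?_)
    · rw [abs_neg, abs_mul, abs_mul, abs_of_nonneg (div_nonneg (ha0 p) (hw p).le)]
      refine mul_le_mul (mul_le_of_le_one_right (div_nonneg (ha0 p) (hw p).le)
        (Real.abs_cos_le_one _)) ((abs_real_inner_le_norm _ _).trans ?_) (abs_nonneg _)
        (div_nonneg (ha0 p) (hw p).le)
      exact mul_le_mul (hgrad _) (hb₀ _) (norm_nonneg _) hM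
    · refine (Finset.abs_sum_le_sum_abs _ _).trans (Finset.sum_le_sum fun q _ => ?_)
      rw [abs_mul, abs_of_nonneg (hk0 p q)]
      refine mul_le_mul_of_nonneg_left ((abs_add_le _ _).trans (add_le_add ?_ ?_)) (hk0 p q)
      · have hpq : 0 < w p + w q := add_pos (hw p) (hw q)
        rw [abs_mul, abs_mul, abs_div, abs_of_pos hpq]
        gcongr
        · exact Real.abs_cos_le_one _
        · exact (abs_real_inner_le_norm _ _).trans
            (mul_le_mul (hgrad _) (hUle t) (norm_nonneg _) hM)
        · exact hbM q
      · rw [abs_mul]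
        refine mul_le_mul (abs_cosMulPrimitive_le _ _ _ _) ((abs_real_inner_le_norm _ _).trans ?_)
          (abs_nonneg _) (hπ0 p q)
        gcongr
        exact (ContinuousLinearMap.le_opNorm _ _).trans
          (mul_le_mul (hhess _) (hUle t) (norm_nonneg _) hL)
  refine ⟨fun t => X t + ∑ p, coef p t • b p,
    fun t => X' t + ∑ p, (-(ε⁻¹ * (a p * Real.cos (φ p t))) - inner ℝ (b p) (g t)
      + ε * R p t) • b p, fun t ht => ?_, ?_, ?_⟩
  · exact (hX t ht).add (HasDerivWithinAt.fun_sum fun p _ => (hcoefd p t ht).smul_const (b p))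
  · intro t
    rw [add_sub_cancel_left]
    exact (hYX t).trans (mul_le_mul_of_nonneg_right (by
      have : 0 ≤ C₃ + N * (C₁ + C₂) := by positivity
      linarith) hε.le)
  · intro t ht
    set Y := X t + ∑ p, coef p t • b p with hY
    have hXY : ‖X t - Y‖ ≤ (C₁ + C₂) * ε := by
      rw [norm_sub_rev, hY, add_sub_cancel_left]
      exact hYX t
    have hsplit : X' t + ∑ p, (-(ε⁻¹ * (a p * Real.cos (φ p t))) - inner ℝ (b p) (g t)
        + ε * R p t) • b p - (b₀ Y - ∑ p, inner ℝ (b p) (gradient J Y) • b p)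
        = (b₀ (X t) - b₀ Y) - ∑ p, inner ℝ (b p) (g t - gradient J Y) • b p
          + ε • ∑ p, R p t • b p := by
      simp only [hX', inner_sub_right, sub_smul, add_smul, neg_smul, Finset.sum_add_distrib,
        Finset.sum_sub_distrib, Finset.sum_neg_distrib, Finset.smul_sum, smul_smul]
      abel
    have h1 : ‖b₀ (X t) - b₀ Y‖ ≤ L₀ * ((C₁ + C₂) * ε) :=
      (hlip _ _).trans (mul_le_mul_of_nonneg_left hXY hL₀)
    have h2 : ‖∑ p, inner ℝ (b p) (g t - gradient J Y) • b p‖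
        ≤ (∑ p, ‖b p‖ * L * ‖b p‖) * ((C₁ + C₂) * ε) := by
      rw [Finset.sum_mul]
      refine (norm_sum_le _ _).trans (Finset.sum_le_sum fun p _ => ?_)
      rw [norm_smul]
      have h3 : ‖g t - gradient J Y‖ ≤ L * ((C₁ + C₂) * ε) :=
        (hglip _ _).trans (mul_le_mul_of_nonneg_left hXY hL)
      calc ‖inner ℝ (b p) (g t - gradient J Y)‖ * ‖b p‖
          ≤ (‖b p‖ * (L * ((C₁ + C₂) * ε))) * ‖b p‖ := by
            gcongr
            exact (norm_inner_le_norm _ _).trans (by gcongr)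
        _ = _ := by ring
    have h3 : ‖ε • ∑ p, R p t • b p‖ ≤ ε * C₃ := by
      rw [norm_smul, Real.norm_of_nonneg hε.le]
      refine mul_le_mul_of_nonneg_left ((norm_sum_le _ _).trans
        (Finset.sum_le_sum fun p _ => ?_)) hε.le
      rw [norm_smul]
      exact mul_le_mul_of_nonneg_right (hRle p t) (norm_nonneg _)
    rw [hsplit]
    calc _ ≤ L₀ * ((C₁ + C₂) * ε) + (∑ p, ‖b p‖ * L * ‖b p‖) * ((C₁ + C₂) * ε) + ε * C₃ :=
          (norm_add_le _ _).trans (add_le_add ((norm_sub_le _ _).trans (add_le_add h1 h2)) h3)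
      _ = (C₃ + N * (C₁ + C₂)) * ε := by rw [hN]; ring
      _ ≤ _ := mul_le_mul_of_nonneg_right (by linarith) hε.le

end Averaging

/-! ### Completeness of maximal solutions -/

section Continuation

variable {E : Type*} [NormedAddCommGroup E] [NormedSpace ℝ E]

/-- On its domain the clock component of a solution is affine. -/
theorem IsSolution.clock_eq {f : E → ℝ → E} {ε τ₀ : ℝ} {x₀ : E} {T : EReal} {x : ℝ → E} {τ : ℝ → ℝ}
    (h : IsSolution f ε x₀ τ₀ T x τ) {t : ℝ} (ht : t ∈ timeDomain T) :
    τ t = τ₀ + (ε ^ 2)⁻¹ * t := by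
  have hsub : Icc 0 t ⊆ timeDomain T := fun u hu =>
    ⟨hu.1, (EReal.coe_le_coe_iff.2 hu.2).trans_lt ht.2⟩
  have hd : ∀ u ∈ Icc 0 t, HasDerivWithinAt (fun u => τ u - (ε ^ 2)⁻¹ * u) 0 (Icc 0 t) u := by
    intro u hu
    have := ((h.deriv_τ u (hsub hu)).mono hsub).sub
      ((hasDerivWithinAt_id u (Icc 0 t)).const_mul (ε ^ 2)⁻¹)
    exact this.congr_deriv (by simp)
  have := (convex_Icc 0 t).norm_image_sub_le_of_norm_hasDerivWithin_le (C := 0) hd (by simp)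
    (left_mem_Icc.2 ht.1) (right_mem_Icc.2 ht.1)
  rw [zero_mul, norm_le_zero_iff, h.init_τ] at this
  linarith

/-- Solutions of a bounded system that is globally Lipschitz in the state are complete when they
cannot be continued. -/
theorem IsMaximalSolution.eq_top [CompleteSpace E] {f : E → ℝ → E} {ε τ₀ : ℝ} {x₀ : E} {T : EReal}
    {x : ℝ → E} {τ : ℝ → ℝ} (hmax : IsMaximalSolution f ε x₀ τ₀ T x τ)
    (hf : Continuous fun p : E × ℝ => f p.1 p.2) {K B : NNReal}
    (hlip : ∀ s, LipschitzWith K fun z => f z s) (hB : ∀ z s, ‖f z s‖ ≤ B) : T = ⊤ := by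
  obtain ⟨hsol, hno⟩ := hmax
  by_contra htop
  have hpos := hsol.pos
  lift T to ℝ using ⟨htop, (EReal.bot_lt_zero.trans hpos).ne'⟩
  have hT : 0 < T := by exact_mod_cast hpos
  set σ : ℝ → ℝ := fun t => τ₀ + (ε ^ 2)⁻¹ * t with hσ
  have hσc : Continuous σ := by fun_prop
  have hsub : timeDomain ((T + 1 : ℝ) : EReal) ⊆ Icc 0 (T + 1) := fun t ht =>
    ⟨ht.1, (EReal.coe_lt_coe_iff.1 ht.2).le⟩
  -- A bounded field moves the state by at most `B (T + 1)`, so with this radius Picard–Lindelöf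
  -- covers all of `[0, T + 1]` at once.
  let a : NNReal := B * ⟨T + 1, by linarith⟩
  have hPL : IsPicardLindelof (fun t z => f z (σ t)) (tmin := 0) (tmax := T + 1)
      ⟨0, by constructor <;> linarith⟩ x₀ a 0 B K :=
    { lipschitzOnWith := fun t _ => (hlip (σ t)).lipschitzOnWith
      continuousOn := fun z _ => (hf.comp (continuous_const.prodMk hσc)).continuousOn
      norm_le := fun t _ z _ => hB z (σ t)
      mul_max_le := by
        have : max (T + 1 - 0) (0 - 0) = T + 1 := by rw [max_eq_left] <;> linarith
        change (B : ℝ) * max (T + 1 - 0) (0 - 0) ≤ (a : ℝ) - ((0 : NNReal) : ℝ)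
        rw [this, NNReal.coe_zero, sub_zero]
        exact le_rfl }
  obtain ⟨y, hy0, hy⟩ := hPL.exists_eq_forall_mem_Icc_hasDerivWithinAt₀
  have hyc : ContinuousOn y (Icc 0 (T + 1)) := fun t ht => (hy t ht).continuousWithinAt
  refine hno ⟨((T + 1 : ℝ) : EReal), y, σ, by exact_mod_cast lt_add_one T, ⟨?_, hy0, by simp [hσ],
    fun t ht => (hy t (hsub ht)).mono hsub, fun t ht => ?_, ?_⟩, fun t ht => ?_,
    fun t ht => (hsol.clock_eq ht).symm⟩
  · exact_mod_cast (by linarith : (0 : ℝ) < T + 1)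
  · exact (((hasDerivWithinAt_id t _).const_mul (ε ^ 2)⁻¹).const_add τ₀).congr_deriv (mul_one _)
  · exact hf.comp_continuousOn ((hyc.mono hsub).prodMk hσc.continuousOn)
  · have htT : t < T := EReal.coe_lt_coe_iff.1 ht.2
    have hin : Icc 0 t ⊆ timeDomain (T : EReal) := fun u hu =>
      ⟨hu.1, EReal.coe_lt_coe_iff.2 (hu.2.trans_lt htT)⟩
    have hin' : Icc 0 t ⊆ Icc 0 (T + 1) := Icc_subset_Icc_right (by linarith)
    refine ODE_solution_unique_of_mem_Icc_right (v := fun u z => f z (σ u)) (K := K)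
      (s := fun _ => univ) (a := 0) (b := t) (fun u _ => (hlip (σ u)).lipschitzOnWith)
      (hyc.mono hin') (fun u hu => ?_) (fun _ _ => mem_univ _)
      (fun u hu => ((hsol.deriv_x u (hin hu)).mono hin).continuousWithinAt) (fun u hu => ?_)
      (fun _ _ => mem_univ _) (by rw [hy0, hsol.init_x]) (right_mem_Icc.2 ht.1)
    · exact ((hy u (hin' (Ico_subset_Icc_self hu))).mono hin').mono_of_mem_nhdsWithin
        (Icc_mem_nhdsGE_of_mem hu)
    · have hu' := Ico_subset_Icc_self hu
      have := ((hsol.deriv_x u (hin hu')).mono hin).mono_of_mem_nhdsWithin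
        (Icc_mem_nhdsGE_of_mem hu)
      rwa [hsol.clock_eq (hin hu')] at this

end Continuation

/-! ### From approximate descent to a `KL` estimate -/

section PracticalStability

variable {E : Type*} [NormedAddCommGroup E] [InnerProductSpace ℝ E] [CompleteSpace E]

theorem abs_sub_le_of_norm_gradient_le {J : E → ℝ} {M : ℝ} (hJ : Differentiable ℝ J)
    (hM : ∀ x, ‖gradient J x‖ ≤ M) (x y : E) : |J x - J y| ≤ M * ‖x - y‖ := by
  refine convex_univ.norm_image_sub_le_of_norm_fderiv_le (𝕜 := ℝ) (fun z _ => hJ z)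
    (fun z _ => ?_) (mem_univ y) (mem_univ x)
  rw [← toDual_gradient, LinearIsometryEquiv.norm_map]
  exact hM z

/-- A curve `X` that is `e`-close to an approximate descent curve `Y` of `J` satisfies a class `KL`
estimate up to `ν`, once `e` is small compared to `ν`. -/
theorem exists_isClassKL_of_approx_descent {J : E → ℝ} {xstar : E} {α : ℝ → ℝ} {M c : ℝ}
    (hJ : Differentiable ℝ J) (hJtop : Tendsto J (cocompact E) atTop)
    (hmin : ∀ x, x ≠ xstar → J xstar < J x) (hα : IsClassK α) (hM : 0 < M) (hc : 0 < c)
    (hlow : ∀ x, α ‖x - xstar‖ ≤ ‖gradient J x‖) (hup : ∀ x, ‖gradient J x‖ ≤ M) :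
    ∃ β, IsClassKL β ∧ ∀ ν, 0 < ν → ∃ δ, 0 < δ ∧ ∀ e, 0 ≤ e → e ≤ δ →
      ∀ (T : ℝ) (X Y Y' : ℝ → E), 0 ≤ T → (∀ t, ‖Y t - X t‖ ≤ e) →
        (∀ t ∈ Icc 0 T, HasDerivWithinAt Y (Y' t) (Icc 0 T) t) →
        (∀ t ∈ Icc 0 T, inner ℝ (gradient J (Y t)) (Y' t)
          ≤ -c * ‖gradient J (Y t)‖ ^ 2 + e * ‖gradient J (Y t)‖) →
        ‖X T - xstar‖ ≤ β ‖X 0 - xstar‖ T + ν := by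
  set V : E → ℝ := fun z => J (z + xstar) - J xstar with hV
  have hVM : ∀ z, V z ≤ M * ‖z‖ := fun z => by
    have := (le_abs_self _).trans (abs_sub_le_of_norm_gradient_le hJ hup (z + xstar) xstar)
    rwa [add_sub_cancel_right] at this
  have hVpos : ∀ z, z ≠ 0 → 0 < V z := fun z hz =>
    sub_pos.2 (hmin _ (by simpa using hz))
  have hV0 : ∀ z, 0 ≤ V z := fun z => by
    by_cases h : z = 0
    · simp [hV, h]
    · exact (hVpos z h).le
  have hVtop : Tendsto V (cocompact E) atTop := by
    have h1 : Tendsto (fun z : E => z + xstar) (cocompact E) (cocompact E) :=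
      (Homeomorph.addRight xstar).isClosedEmbedding.tendsto_cocompact
    exact tendsto_atTop_add_const_right _ _ (hJtop.comp h1)
  obtain ⟨a, ha, haV⟩ := exists_isClassKInfty_le
    (V := V) ((hJ.continuous.comp (continuous_id.add continuous_const)).sub continuous_const)
    hV0 hVpos hVtop
  have hαmono := hα.strictMonoOn.monotoneOn
  have hα0 : ∀ s, 0 ≤ s → 0 ≤ α s := fun s hs => by
    simpa [hα.map_zero] using hαmono (mem_Ici.2 le_rfl) (mem_Ici.2 hs) hs
  have ha0 : ∀ s, 0 ≤ s → 0 ≤ a s := fun s hs => by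
    simpa [ha.map_zero] using ha.strictMonoOn.monotoneOn (mem_Ici.2 le_rfl) (mem_Ici.2 hs) hs
  have hapos : ∀ s, 0 < s → 0 < a s := fun s hs => by
    simpa [ha.map_zero] using ha.strictMonoOn (mem_Ici.2 le_rfl) (mem_Ici.2 hs.le) hs
  have hαpos : ∀ s, 0 < s → 0 < α s := fun s hs => by
    simpa [hα.map_zero] using hα.strictMonoOn (mem_Ici.2 le_rfl) (mem_Ici.2 hs.le) hs
  -- From `V z ≤ M ‖z‖` follows `‖∇J‖ ≥ α (V / M)`. Half of `c` is kept for decay; the other half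
  -- absorbs the error.
  set ρ : ℝ → ℝ := fun s => c / 2 * α (s / M) ^ 2 with hρ
  have hρ0 : ∀ s, 0 ≤ ρ s := fun s => by positivity
  have hρpos : ∀ s, 0 < s → 0 < ρ s := fun s hs => by
    have := hαpos _ (div_pos hs hM)
    positivity
  have hρmono : MonotoneOn ρ (Ici 0) := by
    intro s hs s' hs' h
    have h1 : 0 ≤ s / M := div_nonneg hs hM.le
    have h2 : s / M ≤ s' / M := by gcongr
    have h3 := hαmono (mem_Ici.2 h1) (mem_Ici.2 (h1.trans h2)) h2
    have h4 := hα0 _ h1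
    simp only [hρ]
    gcongr
  have hρc : ContinuousOn ρ (Ici 0) :=
    ((hα.continuousOn.comp (f := fun s => s / M) (by fun_prop)
      (fun s hs => div_nonneg hs hM.le)).pow 2).const_smul (c / 2)
  -- Dividing by `2 * M` rather than `M` leaves room for the initial gap between `X` and `Y`, so
  -- that `β` does not depend on `ν`.
  obtain ⟨β, hβ, hβle⟩ := exists_isClassKL_inverse (fun s t => (a s + t * ρ (a s)) / (2 * M))
    (fun t ht => by
      refine ⟨⟨?_, ?_, ?_⟩, ?_⟩
      · exact (ha.continuousOn.add ((hρc.comp ha.continuousOn ha0).const_smul t)).div_const _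
      · intro s hs s' hs' h
        have h1 := ha.strictMonoOn hs hs' h
        have h2 := hρmono (mem_Ici.2 (ha0 s hs)) (mem_Ici.2 (ha0 s' hs')) h1.le
        have h3 := mul_le_mul_of_nonneg_left h2 ht
        exact div_lt_div_of_pos_right (add_lt_add_of_lt_of_le h1 h3) (by positivity)
      · simp [ha.map_zero, hρ, hα.map_zero]
      · refine tendsto_atTop_mono (fun s => ?_)
          (ha.tendsto_atTop.atTop_div_const (r := 2 * M) (by positivity))
        have := mul_nonneg ht (hρ0 (a s))
        gcongr
        linarith)
    (fun s hs => by fun_prop)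
    (fun s hs t ht t' ht' h => by
      have := mul_lt_mul_of_pos_right h (hρpos _ (hapos s hs))
      exact div_lt_div_of_pos_right (by linarith) (by positivity))
    (fun s hs => (tendsto_atTop_add_const_left _ _
      (tendsto_id.atTop_mul_const (hρpos _ (hapos s hs)))).atTop_div_const (by positivity))
  refine ⟨β, hβ, fun ν hν => ?_⟩
  set m : ℝ := a (ν / 2) with hm
  have hmpos : 0 < m := hapos _ (half_pos hν)
  -- The three bounds on `e` serve, in order, to pass from `Y T` to `X T`, to absorb `e ‖∇J‖` while
  -- `V ≥ m`, and to ensure `M e ≤ m / 2` at time zero.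
  refine ⟨min (ν / 2) (min (c / 2 * α (m / M)) (m / (2 * M))), ?_, ?_⟩
  · have := hαpos _ (div_pos hmpos hM)
    positivity
  intro e he hle T X Y Y' hT hYX hY hdesc
  obtain ⟨he1, he2, he3⟩ : e ≤ ν / 2 ∧ e ≤ c / 2 * α (m / M) ∧ e ≤ m / (2 * M) := by
    simpa only [le_min_iff] using hle
  have htri : ‖X T - xstar‖ ≤ ‖Y T - xstar‖ + e := by
    have h1 : X T - xstar = (Y T - xstar) - (Y T - X T) := by abel
    rw [h1]
    exact (norm_sub_le _ _).trans (by gcongr; exact hYX T)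
  have hβ0 : 0 ≤ β ‖X 0 - xstar‖ T := hβle _ _ _ (norm_nonneg _) le_rfl hT (by
    simp [ha.map_zero, hρ, hα.map_zero])
  rcases le_or_gt (V (Y T - xstar)) m with hVm | hVm
  · have h1 := (haV (Y T - xstar)).trans hVm
    have h2 := (ha.strictMonoOn.le_iff_le (mem_Ici.2 (norm_nonneg _))
      (mem_Ici.2 (half_pos hν).le)).1 h1
    linarith
  · have hderiv : ∀ t ∈ Icc 0 T, HasDerivWithinAt (fun t => V (Y t - xstar))
        (inner ℝ (gradient J (Y t)) (Y' t)) (Icc 0 T) t := fun t ht => by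
      simp only [hV, sub_add_cancel]
      have := (hJ (Y t)).hasFDerivAt.comp_hasDerivWithinAt t (hY t ht)
      rw [← inner_gradient_left] at this
      exact this.sub_const _
    have hdecay : ∀ t ∈ Icc 0 T, m ≤ V (Y t - xstar) →
        inner ℝ (gradient J (Y t)) (Y' t) ≤ -ρ (V (Y t - xstar)) := fun t ht hmt => by
      set G := ‖gradient J (Y t)‖ with hG
      have h1 : V (Y t - xstar) / M ≤ ‖Y t - xstar‖ := by
        rw [div_le_iff₀ hM, mul_comm]
        exact hVM _
      have h0 : 0 ≤ V (Y t - xstar) / M := div_nonneg (hV0 _) hM.le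
      have h2 : α (V (Y t - xstar) / M) ≤ G :=
        (hαmono (mem_Ici.2 h0) (mem_Ici.2 (norm_nonneg _)) h1).trans (hlow _)
      have h3 : α (m / M) ≤ α (V (Y t - xstar) / M) :=
        hαmono (mem_Ici.2 (by positivity)) (mem_Ici.2 h0) (by gcongr)
      have hG0 : 0 ≤ G := norm_nonneg _
      have h4 : e * G ≤ c / 2 * G * G :=
        mul_le_mul_of_nonneg_right (he2.trans (by gcongr; exact h3.trans h2)) hG0
      have h5 : c / 2 * α (V (Y t - xstar) / M) ^ 2 ≤ c / 2 * G ^ 2 := by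
        have := hα0 _ h0
        gcongr
      have h6 := hdesc t ht
      simp only [hρ]
      nlinarith
    have hmain := add_mul_le_of_deriv_le hT hρmono (fun s _ => hρ0 s) hmpos.le hderiv hdecay hVm
    have hY0 : V (Y 0 - xstar) ≤ M * (‖X 0 - xstar‖ + e) := by
      refine (hVM _).trans (mul_le_mul_of_nonneg_left ?_ hM.le)
      have h1 : Y 0 - xstar = (X 0 - xstar) + (Y 0 - X 0) := by abel
      rw [h1]
      exact (norm_add_le _ _).trans (by gcongr; exact hYX 0)
    have hme : e * (2 * M) ≤ m := (le_div_iff₀ (by positivity)).1 he3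
    have hTρ := mul_nonneg hT (hρ0 (V (Y T - xstar)))
    have haY := haV (Y T - xstar)
    -- As `M e ≤ m / 2 < V (Y T - xstar) / 2`, the initial gap is absorbed on the left: `V + 2 T ρ V
    -- ≤ 2 M ‖X 0 - xstar‖`, with `V` taken at `Y T - xstar`.
    have hYle : ‖Y T - xstar‖ ≤ β ‖X 0 - xstar‖ T := by
      refine hβle _ _ _ (norm_nonneg _) (norm_nonneg _) hT ?_
      rw [div_le_iff₀ (by positivity)]
      have h1 := mul_le_mul_of_nonneg_left
        (hρmono (mem_Ici.2 (ha0 _ (norm_nonneg _))) (mem_Ici.2 (hV0 _)) haY) hT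
      nlinarith
    linarith

end PracticalStability

/-! ### The bounded feedback as phase-shifted cosines -/

section ExtremumSeeking

theorem boundedFeedback_eq_cos (ω : ℝ) (j : Fin 2) (y τ : ℝ) :
    boundedFeedback ω j y τ
      = Real.sqrt (2 * ω) * Real.cos (y + ω * τ - ![0, Real.pi / 2] j) := by
  fin_cases j <;> simp [boundedFeedback, Real.cos_sub_pi_div_two]

theorem esField_eq_sum_prod {n r : ℕ} (J : EuclideanSpace ℝ (Fin n) → ℝ)
    (b₀ : EuclideanSpace ℝ (Fin n) → EuclideanSpace ℝ (Fin n))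
    (b : Fin r → Fin 2 → EuclideanSpace ℝ (Fin n)) (ω : Fin r → ℚ)
    (xstar : EuclideanSpace ℝ (Fin n)) (ε : ℝ) (z : EuclideanSpace ℝ (Fin n)) (τ : ℝ) :
    esField J b₀ b ω xstar ε z τ = b₀ (z + xstar) + ε⁻¹ • ∑ p : Fin r × Fin 2,
      (Real.sqrt (2 * (ω p.1 : ℝ)) * Real.cos (J (z + xstar) + (ω p.1 : ℝ) * τ
        - ![0, Real.pi / 2] p.2)) • b p.1 p.2 := by
  simp only [esField, boundedFeedback_eq_cos, Fintype.sum_prod_type]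

/-- Quadrature makes the two channels of one frequency uncorrelated, so no cross term between `b i
0` and `b i 1` survives averaging. -/
theorem cos_phase_shift_sub (i j : Fin 2) :
    Real.cos (![0, Real.pi / 2] j - ![0, Real.pi / 2] i) = if i = j then 1 else 0 := by
  fin_cases i <;> fin_cases j <;> simp

end ExtremumSeeking

/-! ### The stability theorem -/

theorem theorem3 {n r : ℕ}
    (J : EuclideanSpace ℝ (Fin n) → ℝ)
    (b₀ : EuclideanSpace ℝ (Fin n) → EuclideanSpace ℝ (Fin n))
    (b : Fin r → Fin 2 → EuclideanSpace ℝ (Fin n))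
    (ω : Fin r → ℚ) (xstar : EuclideanSpace ℝ (Fin n)) (γ κ₃ : ℝ)
    -- frequencies: positive rationals, pairwise distinct
    (hω_pos : ∀ i, 0 < ω i) (hω_inj : Function.Injective ω)
    -- spanning condition
    (hγ : 0 < γ)
    (hspan : ∀ v : EuclideanSpace ℝ (Fin n),
      γ * ‖v‖ ^ 2 ≤ ∑ i : Fin r, ∑ j : Fin 2, (inner ℝ (b i j) v) ^ 2)
    -- the cost is twice continuously differentiable and radially unbounded
    (hJ : ContDiff ℝ 2 J)
    (hJ_unbounded : Tendsto J (cocompact (EuclideanSpace ℝ (Fin n))) atTop)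
    -- unique minimizer, unique critical point, bounded Hessian
    (hJ_min : ∀ x, x ≠ xstar → J xstar < J x)
    (hJ_crit : ∀ x, gradient J x = 0 ↔ x = xstar)
    (hJ_hess : ∃ LJ : ℝ, 0 < LJ ∧ ∀ x, ‖fderiv ℝ (gradient J) x‖ ≤ LJ)
    -- drift conditions
    (hκ₃ : 0 < κ₃)
    (hb₀_grad : ∀ x, ‖b₀ x‖ ≤ κ₃ * ‖gradient J x‖)
    (hb₀_lip : ∃ L₀ : ℝ, 0 < L₀ ∧ ∀ x₁ x₂, ‖b₀ x₁ - b₀ x₂‖ ≤ L₀ * ‖x₁ - x₂‖)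
    (hγκ : κ₃ < γ)
    -- the gradient is bounded, and bounded below by a class K function
    (hJ_grad : ∃ αJ : ℝ → ℝ, IsClassK αJ ∧ ∃ MJ : ℝ, 0 < MJ ∧
      ∀ x, αJ ‖x - xstar‖ ^ 2 ≤ ‖gradient J x‖ ^ 2 ∧ ‖gradient J x‖ ^ 2 ≤ MJ ^ 2) :
    UGpAS (esField J b₀ b ω xstar) := by
  obtain ⟨L, hL, hhess⟩ := hJ_hess
  obtain ⟨L₀, hL₀, hlip⟩ := hb₀_lip
  obtain ⟨α, hα, M, hM, hαM⟩ := hJ_grad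
  have hup : ∀ x, ‖gradient J x‖ ≤ M := fun x =>
    (sq_le_sq₀ (norm_nonneg _) hM.le).1 (hαM x).2
  have hlow : ∀ x, α ‖x - xstar‖ ≤ ‖gradient J x‖ := fun x =>
    le_of_sq_le_sq (hαM x).1 (norm_nonneg _)
  have hJd : Differentiable ℝ J := hJ.differentiable (by norm_num)
  have hb₀M : ∀ x, ‖b₀ x‖ ≤ κ₃ * M := fun x =>
    (hb₀_grad x).trans (mul_le_mul_of_nonneg_left (hup x) hκ₃.le)
  obtain ⟨C, hC, havg⟩ := exists_near_identity_averaging J b₀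
    (fun p : Fin r × Fin 2 => b p.1 p.2) (fun p => (ω p.1 : ℝ)) (fun p => ![0, Real.pi / 2] p.2)
    (fun p => by exact_mod_cast hω_pos p.1)
    (fun p q hpq => by
      have h1 : p.1 = q.1 := hω_inj (by exact_mod_cast hpq)
      rw [cos_phase_shift_sub]
      simp [Prod.ext_iff, h1])
    hJ hL.le hM.le (mul_nonneg hκ₃.le hM.le) hL₀.le hhess hup hb₀M hlip
  obtain ⟨β, hβ, hpract⟩ := exists_isClassKL_of_approx_descent hJd hJ_unbounded hJ_min hα hM
    (sub_pos.2 hγκ) hlow hup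
  refine ⟨β, hβ, fun ν hν => ?_⟩
  obtain ⟨δ, hδ, hbound⟩ := hpract ν hν
  -- `C + 1` avoids division by zero; the bound `1` is required by the averaging lemma.
  refine ⟨min 1 (δ / (C + 1)), by positivity, fun ε hε hεlt x₀ τ₀ _ T x τ hsol => ⟨?_, ?_⟩⟩
  · intro t ht
    have hsub : Icc 0 t ⊆ timeDomain T := fun u hu =>
      ⟨hu.1, (EReal.coe_le_coe_iff.2 hu.2).trans_lt ht.2⟩
    obtain ⟨Y, Y', hY, hYX, hY'⟩ := havg ε hε (hεlt.le.trans (min_le_left _ _)) (Icc 0 t)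
      (fun u => x u + xstar) τ
      (fun u hu => by
        have := ((hsol.deriv_x u (hsub hu)).mono hsub).add_const xstar
        rwa [esField_eq_sum_prod] at this)
      (fun u hu => (hsol.deriv_τ u (hsub hu)).mono hsub)
    have hCε : C * ε ≤ δ := by
      have h1 : ε * (C + 1) < δ :=
        (lt_div_iff₀ (by positivity)).1 (hεlt.trans_le (min_le_right _ _))
      linarith
    have := hbound (C * ε) (by positivity) hCε t (fun u => x u + xstar) Y Y' ht.1 hYX hY
      (fun u hu => by
        set G := gradient J (Y u) with hG
        set F := b₀ (Y u) - ∑ p : Fin r × Fin 2, inner ℝ (b p.1 p.2) G • b p.1 p.2 with hF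
        -- The averaged field contributes at most `(κ₃ - γ)‖G‖²`, and the averaging error at most `C
        -- ε ‖G‖`.
        have h1 : inner ℝ G (Y' u) = inner ℝ G F + inner ℝ G (Y' u - F) := by
          rw [← inner_add_right, add_sub_cancel]
        have h2 : inner ℝ G (Y' u - F) ≤ ‖G‖ * (C * ε) :=
          (real_inner_le_norm _ _).trans (by gcongr; exact hY' u hu)
        have h3 : inner ℝ G F = inner ℝ G (b₀ (Y u))
            - ∑ i : Fin r, ∑ j : Fin 2, (inner ℝ (b i j) G) ^ 2 := by
          rw [hF, inner_sub_right, inner_sum, Fintype.sum_prod_type]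
          simp only [inner_smul_right]
          simp only [real_inner_comm _ G, sq]
        have h4 : inner ℝ G (b₀ (Y u)) ≤ ‖G‖ * (κ₃ * ‖G‖) :=
          (real_inner_le_norm _ _).trans (by gcongr; exact hb₀_grad _)
        have h5 := hspan G
        linarith)
    simpa [hsol.init_x] using this
  · intro hmax
    set A : ℝ := ∑ p : Fin r × Fin 2, Real.sqrt (2 * (ω p.1 : ℝ)) * ‖b p.1 p.2‖ with hA
    have hA0 : 0 ≤ A := by positivity
    have hb₀c : Continuous b₀ :=
      (LipschitzWith.of_dist_le_mul (K := ⟨L₀, hL₀.le⟩) fun x y => by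
        rw [dist_eq_norm, dist_eq_norm]; exact hlip x y).continuous
    have hJc := hJ.continuous
    -- Both constants grow like `ε⁻¹`, which is harmless because completeness is claimed for each
    -- fixed `ε`.
    refine hmax.eq_top (K := ⟨L₀ + ε⁻¹ * (A * M), by positivity⟩)
      (B := ⟨κ₃ * M + ε⁻¹ * A, by positivity⟩) ?_ (fun s => ?_) (fun z s => ?_)
    · simp only [esField_eq_sum_prod]
      fun_prop
    · refine LipschitzWith.of_dist_le_mul fun z z' => ?_
      have h1 : ∀ p : Fin r × Fin 2,
          ‖(Real.sqrt (2 * (ω p.1 : ℝ)) * Real.cos (J (z + xstar) + (ω p.1 : ℝ) * s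
            - ![0, Real.pi / 2] p.2)) • b p.1 p.2 - (Real.sqrt (2 * (ω p.1 : ℝ)) *
              Real.cos (J (z' + xstar) + (ω p.1 : ℝ) * s - ![0, Real.pi / 2] p.2)) • b p.1 p.2‖
          ≤ Real.sqrt (2 * (ω p.1 : ℝ)) * ‖b p.1 p.2‖ * (M * ‖z - z'‖) := fun p => by
        rw [← sub_smul, ← mul_sub, norm_smul, norm_mul,
          Real.norm_of_nonneg (Real.sqrt_nonneg _), mul_right_comm]
        refine mul_le_mul_of_nonneg_left ((Real.abs_cos_sub_cos_le _ _).trans ?_) (by positivity)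
        have := abs_sub_le_of_norm_gradient_le hJd hup (z + xstar) (z' + xstar)
        rw [add_sub_add_right_eq_sub] at this
        rwa [sub_sub_sub_cancel_right, add_sub_add_right_eq_sub]
      rw [dist_eq_norm, dist_eq_norm, esField_eq_sum_prod, esField_eq_sum_prod,
        add_sub_add_comm, ← smul_sub, ← Finset.sum_sub_distrib]
      refine (norm_add_le _ _).trans ?_
      change _ ≤ (L₀ + ε⁻¹ * (A * M)) * ‖z - z'‖
      rw [add_mul]
      refine add_le_add ?_ ?_
      · simpa using hlip (z + xstar) (z' + xstar)
      · rw [norm_smul, Real.norm_of_nonneg (inv_nonneg.2 hε.le), mul_assoc, mul_assoc]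
        refine mul_le_mul_of_nonneg_left ?_ (inv_nonneg.2 hε.le)
        rw [hA, Finset.sum_mul]
        exact (norm_sum_le _ _).trans (Finset.sum_le_sum fun p _ => h1 p)
    · rw [esField_eq_sum_prod]
      refine (norm_add_le _ _).trans (add_le_add (hb₀M _) ?_)
      rw [norm_smul, Real.norm_of_nonneg (inv_nonneg.2 hε.le)]
      refine mul_le_mul_of_nonneg_left ((norm_sum_le _ _).trans
        (Finset.sum_le_sum fun p _ => ?_)) (inv_nonneg.2 hε.le)
      rw [norm_smul, norm_mul, Real.norm_of_nonneg (Real.sqrt_nonneg _)]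
      gcongr
      exact mul_le_of_le_one_right (Real.sqrt_nonneg _) (Real.abs_cos_le_one _)
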